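/- Let $k\ge 3$ and $n\ge 1$. The Sierpiński graph $S(n,k)$ has vertex set $\{1,\dots,k\}^n$, so $N_n=k^n$ vertices, and $p=p_1\cdots p_n$, $q=q_1\cdots q_n$ are adjacent iff there is $h\in\{1,\dots,n\}$ with $p_i=q_i$ for $i<h$, $p_h\ne q_h$, and $p_i=q_h$, $q_i=p_h$ for all $i>h$. Let $L$ be its Laplacian matrix (degree matrix minus adjacency matrix), and let $x(t)\in\mathbb R^{N_n}$ solve the first-order noisy consensus dynamics $dx(t)=-Lx(t)\,dt+dW(t)$, where $W$ is a standard $N_n$-dimensional Brownian motion (white noise of unit intensity, independent at distinct vertices) and the initial state $x(0)$ is square integrable and independent of $W$. The first-order coherence is the mean steady-state variance of the deviation from the average, $$H_1(S(n,k))=\frac1{N_n}\sum_{i=1}^{N_n}\lim_{t\to\infty}\operatorname{Var}\Bigl(x_i(t)-\frac1{N_n}\sum_{j=1}^{N_n}x_j(t)\Bigr).$$ Then the deviations are square integrable, these limits exist, and $$H_1(S(n,k))=\frac{(k^2+k+2)(k-1)(k+2)^n-4k}{4k^{n+1}(k+1)(k+2)}-\frac{(k-2)(k+1)}{4k(k+2)}.$$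 Moreover, for fixed $k$, as $n\to\infty$, $$H_1(S(n,k))\sim\frac{k^3+k-2}{4k(k+1)(k+2)}\,N_n^{\frac{\log(k+2)}{\log k}-1},$$ that is, the ratio of the two sides tends to $1$. -/

import Mathlib

open MeasureTheory ProbabilityTheory Filter Topology
open scoped NNReal Matrix

/-- The Sierpinski graph `S(n,k)`: its vertices are the words of length `n` over an alphabet of
`k` letters, and `p`, `q` are adjacent iff for some position `h` they agree before `h`, differ at
`h`, and after `h` the word `p` is constantly `q h` while `q` is constantly `p h`. -/
def sierpinskiGraph (n k : ℕ) : SimpleGraph (Fin n → Fin k) where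
  Adj p q := ∃ h : Fin n, (∀ i, i < h → p i = q i) ∧ p h ≠ q h ∧
    ∀ i, h < i → p i = q h ∧ q i = p h
  symm := ⟨fun _ _ ⟨h, h1, h2, h3⟩ =>
    ⟨h, fun i hi => (h1 i hi).symm, h2.symm, fun i hi => (h3 i hi).symm⟩⟩
  loopless := ⟨fun _ ⟨_, _, h2, _⟩ => h2 rfl⟩

section Consensus

variable {V Ω : Type*} [Fintype V] [MeasurableSpace Ω]

open Classical in
/-- `x` solves the first-order noisy consensus dynamics `dx(t) = -L x(t) dt + dW(t)` on the graph
`G`, where `L` is the Laplacian matrix of `G` and `W` is a standard Brownian motion in `ℝ^V`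
(that is, `w = dW/dt` is white noise of unit intensity, independent at distinct vertices).
As the noise is additive, the stochastic differential equation is its integrated form, pathwise.
The initial state is square integrable and independent of the noise. -/
structure IsNoisyConsensus (G : SimpleGraph V) (P : Measure Ω) (W x : ℝ≥0 → Ω → V → ℝ) :
    Prop where
  brownian : ∀ i, IsBrownianReal (fun t ω => W t ω i) P
  noise_indep : iIndepFun (fun (i : V) (ω : Ω) (t : ℝ≥0) => W t ω i) P
  aemeasurable : ∀ t, AEMeasurable (x t) P
  initial_memLp : ∀ i, MemLp (fun ω => x 0 ω i) 2 P
  initial_indep : IndepFun (x 0) (fun (ω : Ω) (t : ℝ≥0) => W t ω) P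
  continuous_paths : ∀ᵐ ω ∂P, Continuous fun t => x t ω
  solution : ∀ᵐ ω ∂P, ∀ (t : ℝ≥0) (i : V),
    x t ω i = x 0 ω i + (∫ s in (0 : ℝ)..t, -(G.lapMatrix ℝ *ᵥ x s.toNNReal ω) i) + W t ω i

/-- The deviation, at time `t`, of the state of vertex `i` from the average of all states. -/
noncomputable def deviation (x : ℝ≥0 → Ω → V → ℝ) (i : V) (t : ℝ≥0) (ω : Ω) : ℝ :=
  x t ω i - (1 / (Fintype.card V : ℝ)) * ∑ j, x t ω j

/-- The first-order coherence: the mean over the vertices of the steady-state (`t → ∞`) variance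
of the deviation from the average. -/
noncomputable def firstOrderCoherence (P : Measure Ω) (x : ℝ≥0 → Ω → V → ℝ) : ℝ :=
  (1 / (Fintype.card V : ℝ)) * ∑ i, limUnder atTop fun t => variance (deviation x i t) P

end Consensus

/-! ### Green matrices under clique insertion. -/

section CliqueInsertion

variable {V D : Type*} [Fintype V] [Fintype D] [DecidableEq D]

/-! The proof has two independent halves, joined by the identity `H₁ = tr M / (2 N)`, where `M` is
the pseudo-inverse of the Laplacian.

Probability: in an orthonormal eigenbasis of `L` the dynamics decouple into Ornstein-Uhlenbeck
processes. Variation of constants, integrated by parts, writes each one through ordinary integrals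
of Brownian paths, so covariances follow from Fubini and no stochastic integral occurs. The initial
state decays in every mode with positive eigenvalue, modes with eigenvalue `0` are removed by
subtracting the average, and the variance at `i` tends to `M i i / 2`
(`IsNoisyConsensus.tendsto_variance_deviation`).

Combinatorics: `S(n+1,k)` arises from `S(n,k)`, made `k`-regular by a loop at each extreme vertex
(`k` loops when `n = 0`), on replacing each vertex by a `k`-clique whose members are its darts. With
`B` the vertex-dart incidence and `P` the dart reversal, this reads `L' = (k+1) - P - BᵀB` and `B P
Bᵀ = k - L`. The Woodbury formula then turns a pseudo-inverse of `L` into one of `L'`, and taking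
traces gives a linear recursion of ratio `k + 2`, solved by `greenTrace`
(`exists_sierpinskiGraph_green`). The ratio `k + 2`, against the factor `k` by which the vertex set
grows, produces the exponent in the asymptotics. -/

/-- The Green matrix of the clique insertion of a `k`-regular graph (with loops) whose Laplacian
has Green matrix `G`: here `B` is the vertex-dart incidence matrix, `P` the dart reversal, and
`J` the all-ones matrix on darts. -/
noncomputable def cliqueGreen (k c : ℝ) (B : Matrix V D ℝ) (P J : Matrix D D ℝ)
    (G : Matrix V V ℝ) : Matrix D D ℝ :=
  (k * (k + 2))⁻¹ • (((k + 1) • (1 : Matrix D D ℝ) + P) +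
    ((k + 1) • (1 : Matrix D D ℝ) + P) * Bᵀ * G * B * ((k + 1) • (1 : Matrix D D ℝ) + P)) -
      (c / k ^ 2) • J

variable {k c : ℝ} {B : Matrix V D ℝ} {P J' : Matrix D D ℝ} {L G J : Matrix V V ℝ}

lemma cliqueGreen_transpose (hPt : Pᵀ = P) (hGt : Gᵀ = G) (hJt : J'ᵀ = J') :
    (cliqueGreen k c B P J' G)ᵀ = cliqueGreen k c B P J' G := by
  simp [cliqueGreen, Matrix.transpose_mul, hPt, hGt, hJt, Matrix.mul_assoc]

/-- This is Woodbury for `A - BᵀB` with `A = (k+1) - P`. As `P² = 1`, `A⁻¹ = S / (k(k+2))` for `S =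
(k+1) + P`, and the Schur complement `1 - B A⁻¹ Bᵀ` equals `L / (k(k+2))`, whose inverse is replaced
by the pseudo-inverse `k(k+2) G`. -/
lemma laplacian_mul_cliqueGreen [DecidableEq V] (hk : k ≠ 0) (hk2 : k + 2 ≠ 0) (hP : P * P = 1)
    (hB : B * Bᵀ = k • (1 : Matrix V V ℝ)) (hBP : B * P * Bᵀ = k • (1 : Matrix V V ℝ) - L)
    (hG : L * G = 1 - c • J) (hBJB : Bᵀ * J * B = J') (hPJ : P * J' = J') (hJP : J' * P = J')
    (hBBJ : Bᵀ * B * J' = k • J') :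
    ((k + 1) • (1 : Matrix D D ℝ) - P - Bᵀ * B) * cliqueGreen k c B P J' G =
      1 - (c / k) • J' := by
  set S : Matrix D D ℝ := (k + 1) • (1 : Matrix D D ℝ) + P with hS
  have h1 : ((k + 1) • (1 : Matrix D D ℝ) - P) * S = (k * (k + 2)) • (1 : Matrix D D ℝ) := by
    simp only [hS, Matrix.mul_add, Matrix.sub_mul, Matrix.smul_mul, Matrix.mul_smul,
      Matrix.one_mul, Matrix.mul_one, hP]
    module
  have h2 : B * S * Bᵀ = (k * (k + 2)) • (1 : Matrix V V ℝ) - L := by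
    simp only [hS, Matrix.mul_add, Matrix.add_mul, Matrix.smul_mul, Matrix.mul_smul,
      Matrix.mul_one, hBP, hB]
    module
  have h3 : J' * S = (k + 2) • J' := by
    simp only [hS, Matrix.mul_add, Matrix.mul_smul, Matrix.mul_one, hJP]
    module
  have h4 : ((k + 1) • (1 : Matrix D D ℝ) - P - Bᵀ * B) * J' = 0 := by
    simp only [Matrix.sub_mul, Matrix.smul_mul, Matrix.one_mul, hPJ, hBBJ]
    module
  have h5 : ((k + 1) • (1 : Matrix D D ℝ) - P - Bᵀ * B) * (S * Bᵀ * G * B * S) =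
      Bᵀ * B * S - (c * (k + 2)) • J' := by
    calc _ = (((k + 1) • (1 : Matrix D D ℝ) - P) * S) * (Bᵀ * G * B * S) -
          Bᵀ * (B * S * Bᵀ) * (G * B * S) := by
            simp only [Matrix.sub_mul, Matrix.mul_assoc]
      _ = Bᵀ * (L * G) * B * S := by
            rw [h1, h2]
            simp only [Matrix.mul_sub, Matrix.sub_mul, Matrix.smul_mul, Matrix.mul_smul,
              Matrix.mul_one, Matrix.one_mul, Matrix.mul_assoc]
            module
      _ = Bᵀ * B * S - c • ((Bᵀ * J * B) * S) := by
            rw [hG]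
            simp only [Matrix.mul_sub, Matrix.sub_mul, Matrix.smul_mul, Matrix.mul_smul,
              Matrix.mul_one, Matrix.mul_assoc]
      _ = _ := by rw [hBJB, h3, smul_smul]
  have h6 : ((k + 1) • (1 : Matrix D D ℝ) - P - Bᵀ * B) * S =
      (k * (k + 2)) • (1 : Matrix D D ℝ) - Bᵀ * B * S := by
    rw [Matrix.sub_mul, h1]
  rw [cliqueGreen, ← hS, Matrix.mul_sub, Matrix.mul_smul, Matrix.mul_smul, h4, Matrix.mul_add,
    h5, h6]
  have : (k * (k + 2))⁻¹ * (c * (k + 2)) = c / k := by field_simp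
  rw [smul_zero, sub_zero, sub_add_sub_cancel, smul_sub, smul_smul, smul_smul, this,
    inv_mul_cancel₀ (mul_ne_zero hk hk2), one_smul]

/-- This fixes the coefficient `c / k²` of the all-ones correction: the Woodbury expression has row
sums `1 / k`, which the correction cancels. -/
lemma cliqueGreen_mul_ones (hk : k ≠ 0) (hk2 : k + 2 ≠ 0) (hPJ : P * J' = J')
    (hGBJ : G * B * J' = 0) {N : ℝ} (hJJ : J' * J' = N • J') (hN : c * N = k) :
    cliqueGreen k c B P J' G * J' = 0 := by
  have h3 : ((k + 1) • (1 : Matrix D D ℝ) + P) * J' = (k + 2) • J' := by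
    simp only [Matrix.add_mul, Matrix.smul_mul, Matrix.one_mul, hPJ]
    module
  rw [cliqueGreen, Matrix.sub_mul, Matrix.smul_mul, Matrix.smul_mul, Matrix.add_mul,
    Matrix.mul_assoc _ _ J', h3, hJJ, Matrix.mul_smul, Matrix.mul_assoc _ _ J',
    Matrix.mul_assoc _ _ (B * J'), ← Matrix.mul_assoc G, hGBJ, Matrix.mul_zero, smul_zero, add_zero,
    smul_smul, smul_smul, ← sub_smul]
  have : (k * (k + 2))⁻¹ * (k + 2) - c / k ^ 2 * N = 0 := by
    rw [div_mul_eq_mul_div, hN]; field_simp; ring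
  rw [this, zero_smul]

/-- By cyclicity only `B S² Bᵀ G` matters, and `S²` is again a combination of `1` and `P`. Hence `B
S² Bᵀ` is affine in `L`, and `L G` has known trace. -/
lemma trace_cliqueGreen [DecidableEq V] (hP : P * P = 1)
    (hB : B * Bᵀ = k • (1 : Matrix V V ℝ)) (hBP : B * P * Bᵀ = k • (1 : Matrix V V ℝ) - L)
    (hG : L * G = 1 - c • J) :
    (cliqueGreen k c B P J' G).trace = (k * (k + 2))⁻¹ * ((k + 1) * Fintype.card D + P.trace +
      k * (k + 2) ^ 2 * G.trace - 2 * (k + 1) * (Fintype.card V - c * J.trace)) -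
        c / k ^ 2 * J'.trace := by
  set S : Matrix D D ℝ := (k + 1) • (1 : Matrix D D ℝ) + P with hS
  have h1 : B * (S * S) * Bᵀ = (k * (k + 2) ^ 2) • (1 : Matrix V V ℝ) - (2 * (k + 1)) • L := by
    have : S * S = ((k + 1) ^ 2 + 1) • (1 : Matrix D D ℝ) + (2 * (k + 1)) • P := by
      simp only [hS, Matrix.mul_add, Matrix.add_mul, Matrix.smul_mul, Matrix.mul_smul,
        Matrix.mul_one, Matrix.one_mul, hP]
      module
    rw [this]
    simp only [Matrix.mul_add, Matrix.add_mul, Matrix.smul_mul, Matrix.mul_smul,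
      Matrix.mul_one, hB, hBP]
    module
  have h2 : (S * Bᵀ * G * B * S).trace =
      k * (k + 2) ^ 2 * G.trace - 2 * (k + 1) * (Fintype.card V - c * J.trace) := by
    calc _ = (B * (S * S) * Bᵀ * G).trace := by
            rw [Matrix.trace_mul_comm, ← Matrix.mul_assoc, ← Matrix.mul_assoc, ← Matrix.mul_assoc,
              Matrix.trace_mul_comm]
            simp only [Matrix.mul_assoc]
      _ = _ := by
            rw [h1]
            simp [Matrix.sub_mul, hG]
  rw [cliqueGreen, ← hS, Matrix.trace_sub, Matrix.trace_smul, Matrix.trace_smul, Matrix.trace_add,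
    h2, hS, Matrix.trace_add, Matrix.trace_smul, Matrix.trace_one]
  simp only [smul_eq_mul]
  ring

end CliqueInsertion

/-! ### Dart reversal on words. -/

section Words

/-- `p` and `q` agree before `h`, differ at `h`, and after `h` each is constantly equal to the
letter of the other at `h`. -/
def SwapAt {n k : ℕ} (h : Fin n) (p q : Fin n → Fin k) : Prop :=
  (∀ i, i < h → p i = q i) ∧ p h ≠ q h ∧ ∀ i, h < i → p i = q h ∧ q i = p h

lemma SwapAt.symm {n k : ℕ} {h : Fin n} {p q : Fin n → Fin k} (H : SwapAt h p q) :
    SwapAt h q p :=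
  ⟨fun i hi => (H.1 i hi).symm, H.2.1.symm, fun i hi => (H.2.2 i hi).symm⟩

lemma SwapAt.ne {n k : ℕ} {h : Fin n} {p q : Fin n → Fin k} (H : SwapAt h p q) : p ≠ q :=
  fun e => H.2.1 (congrFun e h)

lemma SwapAt.pos_unique {n k : ℕ} {h h' : Fin n} {p q : Fin n → Fin k} (H : SwapAt h p q)
    (H' : SwapAt h' p q) : h = h' := by
  rcases lt_trichotomy h h' with hlt | he | hlt
  · exact absurd (H'.1 h hlt) H.2.1
  · exact he
  · exact absurd (H.1 h' hlt) H'.2.1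

lemma sierpinskiGraph_adj {n k : ℕ} {p q : Fin n → Fin k} :
    (sierpinskiGraph n k).Adj p q ↔ ∃ h, SwapAt h p q := Iff.rfl

variable {n k : ℕ}

lemma SwapAt.apply_ne_last {h : Fin (n + 1)} {q r : Fin (n + 1) → Fin k}
    (H : SwapAt h q r) (hh : h ≠ Fin.last n) : q h ≠ q (Fin.last n) := by
  rw [(H.2.2 _ (Fin.lt_last_iff_ne_last.2 hh)).1]
  exact H.2.1

/-- A swap before the last place must occur at the last position where `q` differs from its final
letter; this determines the other word. -/
lemma SwapAt.unique {h h' : Fin (n + 1)} {q r r' : Fin (n + 1) → Fin k}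
    (H : SwapAt h q r) (H' : SwapAt h' q r') (hh : h ≠ Fin.last n) (hh' : h' ≠ Fin.last n) :
    r = r' := by
  have key : ∀ {h h' : Fin (n + 1)} {r r' : Fin (n + 1) → Fin k}, SwapAt h q r → SwapAt h' q r' →
      h ≠ Fin.last n → h' ≠ Fin.last n → ¬ h < h' := by
    intro h h' r r' H H' hh hh' hlt
    have h1 := (H.2.2 h' hlt).1
    have h2 := (H.2.2 _ (Fin.lt_last_iff_ne_last.2 hh)).1
    exact H'.apply_ne_last hh' (h1.trans h2.symm)
  obtain rfl : h = h' := le_antisymm (not_lt.1 (key H' H hh' hh)) (not_lt.1 (key H H' hh hh'))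
  funext i
  rcases lt_trichotomy i h with hlt | rfl | hlt
  · rw [← H.1 i hlt, H'.1 i hlt]
  · rw [← (H.2.2 _ (Fin.lt_last_iff_ne_last.2 hh)).1, (H'.2.2 _ (Fin.lt_last_iff_ne_last.2 hh)).1]
  · rw [(H.2.2 i hlt).2, (H'.2.2 i hlt).2]

lemma exists_swapAt {q : Fin (n + 1) → Fin k} (hq : ¬ ∀ i, q i = q (Fin.last n)) :
    ∃ r h, h ≠ Fin.last n ∧ SwapAt h q r := by
  push Not at hq
  obtain ⟨h, hh, hmax⟩ := Set.Finite.exists_maximal (Set.toFinite {i | q i ≠ q (Fin.last n)}) hq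
  have hgt : ∀ i, h < i → q i = q (Fin.last n) := by
    intro i hi
    by_contra hne
    exact absurd (hmax hne hi.le) (not_le.2 hi)
  -- Beyond the maximal `h`, `q` is constantly its final letter; exchanging that letter with `q h`
  -- gives the neighbour.
  refine ⟨fun i => if i < h then q i else if i = h then q (Fin.last n) else q h, h, ?_, ?_, ?_, ?_⟩
  · rintro rfl
    exact hh rfl
  · intro i hi
    simp [hi]
  · simpa using hh
  · intro i hi
    simp [hi.not_gt, hi.ne', hgt i hi]

open Classical in
/-- The other end of the edge, not in the clique of words with the same initial part, that leaves
the word `q`; it is `q` itself if `q` is constant. -/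
noncomputable def wordRev (q : Fin (n + 1) → Fin k) : Fin (n + 1) → Fin k :=
  if hq : ∃ r h, h ≠ Fin.last n ∧ SwapAt h q r then hq.choose else q

lemma SwapAt.wordRev_eq {h : Fin (n + 1)} {q r : Fin (n + 1) → Fin k} (H : SwapAt h q r)
    (hh : h ≠ Fin.last n) : wordRev q = r := by
  have hq : ∃ r h, h ≠ Fin.last n ∧ SwapAt h q r := ⟨r, h, hh, H⟩
  rw [wordRev, dif_pos hq]
  obtain ⟨h', hh', H'⟩ := hq.choose_spec
  exact H'.unique H hh' hh

lemma wordRev_of_const {q : Fin (n + 1) → Fin k} (hq : ∀ i, q i = q (Fin.last n)) :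
    wordRev q = q := by
  rw [wordRev, dif_neg]
  rintro ⟨r, h, hh, H⟩
  exact H.apply_ne_last hh (hq h)

lemma swapAt_wordRev {q : Fin (n + 1) → Fin k} (hq : ¬ ∀ i, q i = q (Fin.last n)) :
    ∃ h, h ≠ Fin.last n ∧ SwapAt h q (wordRev q) := by
  obtain ⟨r, h, hh, H⟩ := exists_swapAt hq
  exact ⟨h, hh, by rwa [H.wordRev_eq hh]⟩

lemma wordRev_eq_self_iff {q : Fin (n + 1) → Fin k} :
    wordRev q = q ↔ ∀ i, q i = q (Fin.last n) := by
  refine ⟨fun h => ?_, wordRev_of_const⟩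
  by_contra hq
  obtain ⟨_, _, H⟩ := swapAt_wordRev hq
  exact H.ne h.symm

lemma wordRev_wordRev (q : Fin (n + 1) → Fin k) : wordRev (wordRev q) = q := by
  by_cases hq : ∀ i, q i = q (Fin.last n)
  · rw [wordRev_of_const hq, wordRev_of_const hq]
  · obtain ⟨h, hh, H⟩ := swapAt_wordRev hq
    exact H.symm.wordRev_eq hh

lemma init_wordRev_ne {q : Fin (n + 1) → Fin k} (hq : wordRev q ≠ q) :
    Fin.init q ≠ Fin.init (wordRev q) := by
  obtain ⟨h, hh, H⟩ := swapAt_wordRev (mt wordRev_of_const hq)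
  obtain ⟨j, rfl⟩ := Fin.exists_castSucc_eq.2 hh
  exact fun e => H.2.1 (congrFun e j)

lemma eq_of_init_eq {q r : Fin (n + 1) → Fin k} (h : Fin.init q = Fin.init r)
    (hl : q (Fin.last n) = r (Fin.last n)) : q = r := by
  rw [← Fin.snoc_init_self q, ← Fin.snoc_init_self r, h, hl]

/-- The clique-insertion structure: swaps at the last place are the clique edges, swaps elsewhere
are the edges inherited from level `n`. -/
lemma sierpinskiGraph_succ_adj {q r : Fin (n + 1) → Fin k} (hqr : q ≠ r) :
    (sierpinskiGraph (n + 1) k).Adj q r ↔ Fin.init q = Fin.init r ∨ wordRev q = r := by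
  rw [sierpinskiGraph_adj]
  constructor
  · rintro ⟨h, H⟩
    by_cases hh : h = Fin.last n
    · subst hh
      exact Or.inl (funext fun i => H.1 _ (Fin.castSucc_lt_last i))
    · exact Or.inr (H.wordRev_eq hh)
  · rintro (h | rfl)
    · refine ⟨Fin.last n, fun i hi => ?_, fun hl => hqr (eq_of_init_eq h hl), fun i hi =>
        absurd (Fin.le_last i) (not_le.2 hi)⟩
      obtain ⟨j, rfl⟩ := Fin.exists_castSucc_eq.2 hi.ne
      exact congrFun h j
    · obtain ⟨h, -, H⟩ := swapAt_wordRev (mt wordRev_of_const hqr.symm)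
      exact ⟨h, H⟩

lemma swapAt_castSucc_iff {h : Fin n} {q r : Fin (n + 1) → Fin k} :
    SwapAt h.castSucc q r ↔ SwapAt h (Fin.init q) (Fin.init r) ∧
      q (Fin.last n) = Fin.init r h ∧ r (Fin.last n) = Fin.init q h := by
  simp only [SwapAt, Fin.forall_fin_succ', Fin.init, Fin.castSucc_lt_castSucc_iff,
    Fin.castSucc_lt_last, forall_const, (Fin.castSucc_lt_last h).not_gt, false_implies, and_true]
  tauto

/-- Distinct words `p`, `p'` are adjacent iff a (unique) word extending `p` is reversed into a word
extending `p'`. -/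
lemma card_init_wordRev {p p' : Fin n → Fin k} (hp : p ≠ p')
    [Decidable ((sierpinskiGraph n k).Adj p p')] :
    (Finset.univ.filter fun q : Fin (n + 1) → Fin k =>
      Fin.init q = p ∧ Fin.init (wordRev q) = p').card =
      if (sierpinskiGraph n k).Adj p p' then 1 else 0 := by
  have key : ∀ q : Fin (n + 1) → Fin k, Fin.init q = p ∧ Fin.init (wordRev q) = p' ↔
      ∃ h, SwapAt h p p' ∧ q = Fin.snoc (α := fun _ => Fin k) p (p' h) := by
    intro q
    constructor
    · rintro ⟨rfl, rfl⟩
      have hq : wordRev q ≠ q := fun e => hp (by rw [e])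
      obtain ⟨h, hh, H⟩ := swapAt_wordRev (mt wordRev_of_const hq)
      obtain ⟨j, rfl⟩ := Fin.exists_castSucc_eq.2 hh
      have H' := swapAt_castSucc_iff.1 H
      exact ⟨j, H'.1, by rw [← H'.2.1, Fin.snoc_init_self]⟩
    · rintro ⟨h, H, rfl⟩
      have : SwapAt h.castSucc (Fin.snoc (α := fun _ => Fin k) p (p' h))
          (Fin.snoc (α := fun _ => Fin k) p' (p h)) := by
        rw [swapAt_castSucc_iff]
        simpa using H
      rw [this.wordRev_eq (Fin.castSucc_lt_last h).ne]
      simp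
  split_ifs with hA
  · obtain ⟨h, H⟩ := hA
    rw [Finset.card_eq_one]
    refine ⟨Fin.snoc (α := fun _ => Fin k) p (p' h), ?_⟩
    ext q
    simp only [Finset.mem_filter, Finset.mem_univ, true_and, Finset.mem_singleton, key q]
    constructor
    · rintro ⟨h', H', rfl⟩
      rw [SwapAt.pos_unique H H']
    · rintro rfl
      exact ⟨h, H, rfl⟩
  · rw [Finset.card_eq_zero, Finset.filter_eq_empty_iff]
    rintro q - hq
    obtain ⟨h, H, -⟩ := (key q).1 hq
    exact hA ⟨h, H⟩

lemma card_init_eq (p : Fin n → Fin k) :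
    (Finset.univ.filter fun q : Fin (n + 1) → Fin k => Fin.init q = p).card = k := by
  rw [show (Finset.univ.filter fun q : Fin (n + 1) → Fin k => Fin.init q = p) =
    Finset.univ.image fun c => Fin.snoc (α := fun _ => Fin k) p c from ?_]
  · rw [Finset.card_image_of_injective, Finset.card_univ, Fintype.card_fin]
    exact fun c c' h => by simpa using congrFun h (Fin.last n)
  · ext q
    simp only [Finset.mem_filter, Finset.mem_univ, true_and, Finset.mem_image]
    constructor
    · rintro rfl
      exact ⟨q (Fin.last n), Fin.snoc_init_self q⟩
    · rintro ⟨c, rfl⟩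
      simp

lemma card_wordRev_eq_self :
    (Finset.univ.filter fun q : Fin (n + 1) → Fin k => wordRev q = q).card = k := by
  rw [show (Finset.univ.filter fun q : Fin (n + 1) → Fin k => wordRev q = q) =
    Finset.univ.image fun c _ => c from ?_]
  · rw [Finset.card_image_of_injective, Finset.card_univ, Fintype.card_fin]
    exact fun c c' h => congrFun h (Fin.last n)
  · ext q
    simp only [Finset.mem_filter, Finset.mem_univ, true_and, Finset.mem_image,
      wordRev_eq_self_iff]
    constructor
    · exact fun h => ⟨q (Fin.last n), funext fun i => (h i).symm⟩
    · rintro ⟨c, rfl⟩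
      simp

end Words

/-! ### The matrix recursion and the trace of the Green matrix. -/

section WordMatrices

/-- The incidence matrix between words of length `n` and their extensions by one letter. -/
def wordInc (n k : ℕ) : Matrix (Fin n → Fin k) (Fin (n + 1) → Fin k) ℝ :=
  Matrix.of fun p q => if Fin.init q = p then 1 else 0

/-- The permutation matrix of `wordRev`. -/
noncomputable def wordRevMatrix (n k : ℕ) :
    Matrix (Fin (n + 1) → Fin k) (Fin (n + 1) → Fin k) ℝ :=
  Matrix.of fun q r => if wordRev q = r then 1 else 0

/-- The all-ones matrix. -/
def onesMatrix (V : Type*) : Matrix V V ℝ := Matrix.of fun _ _ => 1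

variable {n k : ℕ}

lemma wordRevMatrix_mul (m : Type*) (A : Matrix (Fin (n + 1) → Fin k) m ℝ) :
    wordRevMatrix n k * A = Matrix.of fun q r => A (wordRev q) r := by
  ext q r
  simp [wordRevMatrix, Matrix.mul_apply]

lemma wordRevMatrix_mul_self : wordRevMatrix n k * wordRevMatrix n k = 1 := by
  rw [wordRevMatrix_mul]
  ext q r
  simp [wordRevMatrix, wordRev_wordRev, Matrix.one_apply]

lemma wordRevMatrix_transpose : (wordRevMatrix n k)ᵀ = wordRevMatrix n k := by
  ext q r
  have : wordRev r = q ↔ wordRev q = r :=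
    ⟨fun h => by rw [← h, wordRev_wordRev], fun h => by rw [← h, wordRev_wordRev]⟩
  simp [wordRevMatrix, this]

lemma trace_wordRevMatrix : (wordRevMatrix n k).trace = k := by
  simp only [Matrix.trace, Matrix.diag, wordRevMatrix, Matrix.of_apply, Finset.sum_boole,
    card_wordRev_eq_self]

lemma onesMatrix_transpose (V : Type*) : (onesMatrix V)ᵀ = onesMatrix V := rfl

lemma onesMatrix_mul_self (V : Type*) [Fintype V] :
    onesMatrix V * onesMatrix V = (Fintype.card V : ℝ) • onesMatrix V := by
  ext
  simp [onesMatrix, Matrix.mul_apply]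

lemma trace_onesMatrix (V : Type*) [Fintype V] : (onesMatrix V).trace = Fintype.card V := by
  simp [onesMatrix, Matrix.trace]

lemma wordRevMatrix_mul_ones :
    wordRevMatrix n k * onesMatrix _ = onesMatrix (Fin (n + 1) → Fin k) := by
  rw [wordRevMatrix_mul]
  rfl

lemma ones_mul_wordRevMatrix :
    onesMatrix (Fin (n + 1) → Fin k) * wordRevMatrix n k = onesMatrix _ := by
  have := congrArg Matrix.transpose (wordRevMatrix_mul_ones (n := n) (k := k))
  rwa [Matrix.transpose_mul, wordRevMatrix_transpose, onesMatrix_transpose] at this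

lemma wordInc_mul_transpose : wordInc n k * (wordInc n k)ᵀ = (k : ℝ) • 1 := by
  ext p p'
  simp only [wordInc, Matrix.mul_apply, Matrix.of_apply, Matrix.transpose_apply,
    Matrix.smul_apply, Matrix.one_apply, smul_eq_mul]
  by_cases h : p = p'
  · subst h
    simp only [mul_ite, mul_one, mul_zero, if_true]
    rw [← congrArg (Nat.cast (R := ℝ)) (card_init_eq p), ← Finset.sum_boole]
    exact Finset.sum_congr rfl fun q _ => by split_ifs <;> rfl
  · simp only [h, if_false, mul_zero]
    refine Finset.sum_eq_zero fun q _ => ?_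
    by_cases h1 : Fin.init q = p
    · simp [h1, h]
    · simp [h1]

lemma transpose_wordInc_mul_ones :
    (wordInc n k)ᵀ * onesMatrix (Fin n → Fin k) * wordInc n k =
      onesMatrix (Fin (n + 1) → Fin k) := by
  ext q r
  simp [wordInc, onesMatrix, Matrix.mul_apply]

lemma wordInc_mul_ones (q : Fin n → Fin k) (r : Fin (n + 1) → Fin k) :
    (wordInc n k * onesMatrix (Fin (n + 1) → Fin k)) q r = k := by
  simp [wordInc, onesMatrix, Matrix.mul_apply, card_init_eq]

lemma transpose_wordInc_mul_wordInc_mul_ones :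
    (wordInc n k)ᵀ * wordInc n k * onesMatrix (Fin (n + 1) → Fin k) =
      (k : ℝ) • onesMatrix (Fin (n + 1) → Fin k) := by
  rw [Matrix.mul_assoc]
  ext q r
  rw [Matrix.mul_apply]
  simp only [wordInc_mul_ones, ← Finset.sum_mul]
  simp [wordInc, onesMatrix]

/-- Matrices that agree off the diagonal and have the same row sums are equal. -/
lemma matrix_eq_of_offDiag {V : Type*} [Fintype V] [DecidableEq V] {A B : Matrix V V ℝ}
    (h : ∀ i j, i ≠ j → A i j = B i j) (hs : ∀ i, ∑ j, A i j = ∑ j, B i j) : A = B := by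
  ext i j
  by_cases hij : i = j
  · subst hij
    have := hs i
    rw [← Finset.add_sum_erase _ _ (Finset.mem_univ i),
      ← Finset.add_sum_erase _ (B i) (Finset.mem_univ i),
      Finset.sum_congr rfl fun j hj => h i j (Finset.ne_of_mem_erase hj).symm] at this
    exact add_right_cancel this
  · exact h i j hij

lemma sum_lapMatrix {V : Type*} [Fintype V] [DecidableEq V] (G : SimpleGraph V)
    [DecidableRel G.Adj] (i : V) : ∑ j, G.lapMatrix ℝ i j = 0 := by
  have := congrFun (G.lapMatrix_mulVec_const_eq_zero (R := ℝ)) i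
  simpa [Matrix.mulVec, dotProduct] using this

lemma lapMatrix_apply_ne {V : Type*} [Fintype V] [DecidableEq V] (G : SimpleGraph V)
    [DecidableRel G.Adj] {i j : V} (h : i ≠ j) :
    G.lapMatrix ℝ i j = - if G.Adj i j then 1 else 0 := by
  simp [SimpleGraph.lapMatrix, SimpleGraph.degMatrix, h, SimpleGraph.adjMatrix_apply]

lemma transpose_wordInc_mul_wordInc :
    (wordInc n k)ᵀ * wordInc n k = Matrix.of fun q r => if Fin.init q = Fin.init r then 1 else 0 := by
  ext q r
  simp [wordInc, Matrix.mul_apply, eq_comm]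

/-- Both sides have zero row sums, so only off-diagonal entries need comparison and no degree is
computed. At a constant word the diagonal entry of the reversal matrix accounts for the missing
edge. -/
lemma lapMatrix_sierpinskiGraph_succ [DecidableRel (sierpinskiGraph (n + 1) k).Adj] :
    (sierpinskiGraph (n + 1) k).lapMatrix ℝ =
      ((k : ℝ) + 1) • (1 : Matrix _ _ ℝ) - wordRevMatrix n k - (wordInc n k)ᵀ * wordInc n k := by
  refine matrix_eq_of_offDiag (fun q r hqr => ?_) fun q => ?_
  · rw [lapMatrix_apply_ne _ hqr, transpose_wordInc_mul_wordInc]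
    simp only [sierpinskiGraph_succ_adj hqr, wordRevMatrix, Matrix.sub_apply, Matrix.smul_apply,
      Matrix.of_apply, Matrix.one_apply_ne hqr]
    by_cases h1 : wordRev q = r
    · subst h1
      simp [init_wordRev_ne hqr.symm]
    · simp [h1]
  · rw [sum_lapMatrix]
    have h : ∀ A : Matrix (Fin (n + 1) → Fin k) (Fin (n + 1) → Fin k) ℝ,
        ∑ r, A q r = (A * onesMatrix (Fin (n + 1) → Fin k)) q q := by
      intro A
      simp [Matrix.mul_apply, onesMatrix]
    rw [h, Matrix.sub_mul, Matrix.sub_mul, wordRevMatrix_mul_ones,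
      transpose_wordInc_mul_wordInc_mul_ones]
    simp [onesMatrix]

lemma wordInc_mul_wordRevMatrix_mul [DecidableRel (sierpinskiGraph n k).Adj] :
    wordInc n k * wordRevMatrix n k * (wordInc n k)ᵀ =
      (k : ℝ) • 1 - (sierpinskiGraph n k).lapMatrix ℝ := by
  rw [Matrix.mul_assoc, wordRevMatrix_mul]
  refine matrix_eq_of_offDiag (fun p p' hp => ?_) fun p => ?_
  · have := card_init_wordRev (k := k) hp
    simp only [Matrix.sub_apply, lapMatrix_apply_ne _ hp, Matrix.smul_apply,
      Matrix.one_apply_ne hp, smul_zero, zero_sub, neg_neg]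
    have h := congrArg (Nat.cast (R := ℝ)) this
    rw [← Finset.sum_boole] at h
    push_cast at h
    rw [← h, Matrix.mul_apply]
    refine Finset.sum_congr rfl fun q _ => ?_
    simp only [wordInc, Matrix.of_apply, Matrix.transpose_apply]
    split_ifs <;> simp_all
  · simp only [Matrix.sub_apply, Finset.sum_sub_distrib, sum_lapMatrix, Matrix.mul_apply]
    rw [Finset.sum_comm]
    simp [wordInc, Matrix.one_apply, card_init_eq]

/-- The trace of the Green matrix of `S(n,k)`. -/
noncomputable def greenTrace (k : ℝ) (n : ℕ) : ℝ :=
  2 * k ^ n * ((k ^ 2 + k + 2) * (k - 1) * (k + 2) ^ n - 4 * k) /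
      (4 * k ^ (n + 1) * (k + 1) * (k + 2)) -
    2 * k ^ n * ((k - 2) * (k + 1) / (4 * k * (k + 2)))

lemma greenTrace_zero {k : ℝ} (hk : 0 < k) : greenTrace k 0 = 0 := by
  rw [greenTrace]
  field_simp
  ring

lemma greenTrace_succ {k : ℝ} (hk : 0 < k) (n : ℕ) :
    greenTrace k (n + 1) = (k * (k + 2))⁻¹ * ((k + 1) * k ^ (n + 1) + k +
      k * (k + 2) ^ 2 * greenTrace k n - 2 * (k + 1) * (k ^ n - 1)) - 1 / k := by
  rw [greenTrace, greenTrace]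
  field_simp
  ring

open Classical in
/-- The Laplacian of `S(n,k)` has a symmetric pseudo-inverse, of explicit trace. -/
theorem exists_sierpinskiGraph_green (hk : 0 < k) (n : ℕ) :
    ∃ G : Matrix (Fin n → Fin k) (Fin n → Fin k) ℝ, Gᵀ = G ∧
      (sierpinskiGraph n k).lapMatrix ℝ * G = 1 - (1 / (k : ℝ) ^ n) • onesMatrix _ ∧
      G * onesMatrix _ = 0 ∧ G.trace = greenTrace k n := by
  have hk' : (0 : ℝ) < k := by exact_mod_cast hk
  induction n with
  | zero =>
    -- `S(0,k)` is a single vertex, with zero Laplacian and zero Green matrix.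
    refine ⟨0, by simp, ?_, by simp, by simp [greenTrace_zero hk']⟩
    ext p q
    rw [Subsingleton.elim p q]
    simp [onesMatrix]
  | succ n ih =>
    obtain ⟨G, h1, h2, h3, h4⟩ := ih
    have hGB : G * wordInc n k * onesMatrix (Fin (n + 1) → Fin k) = 0 := by
      rw [Matrix.mul_assoc]
      ext p q
      have h5 := congrFun₂ h3 p p
      rw [Matrix.mul_apply] at h5
      simp only [onesMatrix, Matrix.of_apply, mul_one, Matrix.zero_apply] at h5
      rw [Matrix.mul_apply]
      simp only [wordInc_mul_ones, ← Finset.sum_mul, h5, zero_mul, Matrix.zero_apply]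
    refine ⟨cliqueGreen k (1 / (k : ℝ) ^ n) (wordInc n k) (wordRevMatrix n k) (onesMatrix _) G,
      cliqueGreen_transpose wordRevMatrix_transpose h1 (onesMatrix_transpose _), ?_, ?_, ?_⟩
    · rw [lapMatrix_sierpinskiGraph_succ, laplacian_mul_cliqueGreen hk'.ne' (by positivity)
        wordRevMatrix_mul_self wordInc_mul_transpose wordInc_mul_wordRevMatrix_mul h2
        transpose_wordInc_mul_ones wordRevMatrix_mul_ones ones_mul_wordRevMatrix
        transpose_wordInc_mul_wordInc_mul_ones, div_div, pow_succ]
    · refine cliqueGreen_mul_ones hk'.ne' (by positivity) wordRevMatrix_mul_ones hGB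
        (onesMatrix_mul_self _) ?_
      simp [pow_succ]
      field_simp
    · rw [trace_cliqueGreen wordRevMatrix_mul_self wordInc_mul_transpose
        wordInc_mul_wordRevMatrix_mul h2, trace_wordRevMatrix, h4, trace_onesMatrix,
        trace_onesMatrix, greenTrace_succ hk']
      simp only [Fintype.card_fun, Fintype.card_fin, Nat.cast_pow]
      field_simp
      ring

end WordMatrices

/-! ### Fubini for covariances of integrated processes. -/

section IntegralOfProcess

variable {S Ω : Type*} [MeasurableSpace S] [MeasurableSpace Ω] {P : Measure Ω}
  [IsProbabilityMeasure P] {ν : Measure S} [IsFiniteMeasure ν] {X : S → Ω → ℝ}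

/-- The integral over a parameter of a square integrable process is square integrable. -/
lemma memLp_two_integral (hX : MemLp (Function.uncurry X) 2 (ν.prod P)) :
    MemLp (fun ω => ∫ s, X s ω ∂ν) 2 P := by
  have hm : AEStronglyMeasurable (fun ω => ∫ s, X s ω ∂ν) P :=
    hX.1.prod_swap.integral_prod_right'
  have hsq : Integrable (fun z : S × Ω => X z.1 z.2 ^ 2) (ν.prod P) := hX.integrable_sq
  have hi1 : Integrable (fun z : S × Ω => X z.1 z.2) (ν.prod P) := hX.integrable one_le_two
  refine (memLp_two_iff_integrable_sq hm).2 ?_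
  refine Integrable.mono' ((hsq.integral_prod_right).const_mul (ν.real Set.univ)) (hm.pow 2) ?_
  filter_upwards [hsq.prod_left_ae, hi1.prod_left_ae] with ω h1 h2
  -- Cauchy-Schwarz against the constant `1`, obtained by expanding a nonnegative square;
  -- multiplying by the total mass avoids dividing by it.
  have h3 : 0 ≤ ∫ s, (ν.real Set.univ * X s ω - ∫ r, X r ω ∂ν) ^ 2 ∂ν :=
    integral_nonneg fun s => sq_nonneg _
  have h4 : ∫ s, (ν.real Set.univ * X s ω - ∫ r, X r ω ∂ν) ^ 2 ∂ν =
      ν.real Set.univ * (ν.real Set.univ * ∫ s, X s ω ^ 2 ∂ν - (∫ s, X s ω ∂ν) ^ 2) := by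
    have : ∀ s, (ν.real Set.univ * X s ω - ∫ r, X r ω ∂ν) ^ 2 =
        ν.real Set.univ ^ 2 * X s ω ^ 2 - (2 * ν.real Set.univ * ∫ r, X r ω ∂ν) * X s ω +
          (∫ r, X r ω ∂ν) ^ 2 := fun s => by ring
    simp only [this]
    have h5 : Integrable (fun s => ν.real Set.univ ^ 2 * X s ω ^ 2 -
        (2 * ν.real Set.univ * ∫ r, X r ω ∂ν) * X s ω) ν :=
      (h1.const_mul _).sub (h2.const_mul _)
    rw [integral_add h5 (integrable_const _),
      integral_sub (h1.const_mul _) (h2.const_mul _), integral_const_mul, integral_const_mul,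
      integral_const, smul_eq_mul]
    ring
  rw [h4] at h3
  rw [Real.norm_eq_abs, abs_of_nonneg (sq_nonneg _)]
  rcases eq_or_lt_of_le (measureReal_nonneg (μ := ν) (s := Set.univ)) with h0 | h0
  · have hν : ν = 0 := by
      rw [← Measure.measure_univ_eq_zero]
      exact (measureReal_eq_zero_iff).1 h0.symm
    simp [hν]
  · exact sub_nonneg.1 (nonneg_of_mul_nonneg_right h3 h0)

lemma covariance_integral_left (hX : MemLp (Function.uncurry X) 2 (ν.prod P))
    (hX' : ∀ᵐ s ∂ν, MemLp (X s) 2 P) {Y : Ω → ℝ} (hY : MemLp Y 2 P) :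
    cov[fun ω => ∫ s, X s ω ∂ν, Y; P] = ∫ s, cov[X s, Y; P] ∂ν := by
  have hi1 : Integrable (Function.uncurry X) (ν.prod P) := hX.integrable one_le_two
  have hi2 : Integrable (Function.uncurry fun s ω => X s ω * Y ω) (ν.prod P) :=
    hX.integrable_mul (hY.comp_snd ν)
  rw [covariance_eq_sub (memLp_two_integral hX) hY]
  have h1 : ∫ ω, ∫ s, X s ω ∂ν ∂P = ∫ s, ∫ ω, X s ω ∂P ∂ν := (integral_integral_swap hi1).symm
  have h2 : ∫ ω, (∫ s, X s ω ∂ν) * Y ω ∂P = ∫ s, ∫ ω, X s ω * Y ω ∂P ∂ν := by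
    rw [integral_integral_swap hi2]
    simp only [integral_mul_const]
  have h3 : ∫ s, cov[X s, Y; P] ∂ν = ∫ s, ((∫ ω, X s ω * Y ω ∂P) - (∫ ω, X s ω ∂P) * P[Y]) ∂ν := by
    refine integral_congr_ae ?_
    filter_upwards [hX'] with s hs
    rw [covariance_eq_sub hs hY]
    rfl
  have h4 : Integrable (fun s => ∫ ω, X s ω * Y ω ∂P) ν := hi2.integral_prod_left
  have h5 : Integrable (fun s => ∫ ω, X s ω ∂P) ν := hi1.integral_prod_left
  rw [h3, integral_sub h4 (h5.mul_const _), integral_mul_const, ← h1, ← h2]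
  rfl

end IntegralOfProcess

/-! ### Joint measurability and integrability of Brownian motion. -/

section BrownianMeasurability

variable {Ω : Type*} [MeasurableSpace Ω] {P : Measure Ω}

/-- A process with almost surely continuous paths is jointly almost everywhere measurable. -/
lemma aestronglyMeasurable_uncurry_of_continuous [SFinite P] {X : ℝ≥0 → Ω → ℝ}
    (hX : ∀ t, AEMeasurable (X t) P) (hc : ∀ᵐ ω ∂P, Continuous (X · ω)) (ν : Measure ℝ)
    [SFinite ν] :
    AEStronglyMeasurable (Function.uncurry fun (s : ℝ) ω => X s.toNNReal ω) (ν.prod P) := by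
  have hlim : ∀ s : ℝ≥0, Tendsto (fun m : ℕ => (⌊(s : ℝ) * m⌋₊ : ℝ≥0) / m) atTop (𝓝 s) := by
    intro s
    have := (tendsto_nat_floor_mul_div_atTop (R := ℝ) s.2).comp tendsto_natCast_atTop_atTop
    rw [← NNReal.tendsto_coe]
    refine this.congr fun m => ?_
    simp
  have hgrid : ∀ᵐ ω ∂P, ∀ m j : ℕ,
      (hX ((j : ℝ≥0) / m)).mk _ ω = X ((j : ℝ≥0) / m) ω := by
    rw [ae_all_iff]; intro m
    rw [ae_all_iff]; intro j
    exact (hX ((j : ℝ≥0) / m)).ae_eq_mk.symm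
  -- Sampling at the grid times `⌊s m⌋ / m` uses countably many times in all, so measurable
  -- modifications agree with the process there off a single null set.
  refine aestronglyMeasurable_of_tendsto_ae atTop (f := fun (m : ℕ) (z : ℝ × Ω) =>
    (hX ((⌊(z.1.toNNReal : ℝ) * m⌋₊ : ℝ≥0) / m)).mk _ z.2) (fun m => ?_) ?_
  · have h1 : Measurable fun z : ℕ × Ω => (hX ((z.1 : ℝ≥0) / m)).mk _ z.2 :=
      measurable_from_prod_countable_right fun j => (hX ((j : ℝ≥0) / m)).measurable_mk
    have h2 : Measurable fun z : ℝ × Ω => (⌊(z.1.toNNReal : ℝ) * m⌋₊, z.2) :=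
      (Nat.measurable_floor.comp ((measurable_coe_nnreal_real.comp
        (measurable_real_toNNReal.comp measurable_fst)).mul_const _)).prodMk measurable_snd
    exact (h1.comp h2).aestronglyMeasurable
  · have h := Measure.quasiMeasurePreserving_snd (μ := ν) (ν := P) |>.ae (hc.and hgrid)
    filter_upwards [h] with z hz
    simp only [hz.2]
    exact (hz.1.tendsto _).comp (hlim _)

lemma ProbabilityTheory.IsBrownianReal.memLp_eval {B : ℝ≥0 → Ω → ℝ}
    (hB : IsBrownianReal B P) (t : ℝ≥0) :
    MemLp (B t) 2 P :=
  (hB.isGaussianProcess.hasGaussianLaw_eval t).memLp_two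

lemma ProbabilityTheory.IsBrownianReal.memLp_uncurry [IsProbabilityMeasure P]
    {B : ℝ≥0 → Ω → ℝ} (hB : IsBrownianReal B P) (t : ℝ) :
    MemLp (Function.uncurry fun (s : ℝ) ω => B s.toNNReal ω) 2
      ((volume.restrict (Set.Ioc 0 t)).prod P) := by
  have hm := aestronglyMeasurable_uncurry_of_continuous (fun s => hB.aemeasurable s) hB.cont
    (volume.restrict (Set.Ioc 0 t))
  refine (memLp_two_iff_integrable_sq hm).2 ((integrable_prod_iff (hm.pow 2)).2 ⟨?_, ?_⟩)
  · exact Eventually.of_forall fun s => (hB.memLp_eval s.toNNReal).integrable_sq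
  · have : ∀ s : ℝ, ∫ ω, ‖B s.toNNReal ω ^ 2‖ ∂P = s.toNNReal := by
      intro s
      have h := hB.covariance_eval s.toNNReal s.toNNReal
      rw [covariance_eq_sub (hB.memLp_eval _) (hB.memLp_eval _), hB.integral_eval] at h
      simp only [min_self, mul_zero, sub_zero] at h
      rw [← h]
      refine integral_congr_ae (Eventually.of_forall fun ω => ?_)
      simp [sq]
    simp only [Function.uncurry, Pi.pow_apply, this]
    exact ((NNReal.continuous_coe.comp continuous_real_toNNReal).integrableOn_Icc).mono_set
      Set.Ioc_subset_Icc_self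

end BrownianMeasurability

/-! ### Variation of constants and the deterministic integrals. -/

section LinearEquation

/-- Variation of constants for the integral equation `y(t) = y₀ - l ∫₀ᵗ y + b(t)`. -/
lemma eq_exp_mul_add_of_integral_eq {y b : ℝ → ℝ} (hy : Continuous y) (hb : Continuous b)
    {l y₀ : ℝ} (h : ∀ t, 0 ≤ t → y t = y₀ - l * (∫ s in (0 : ℝ)..t, y s) + b t) {t : ℝ}
    (ht : 0 ≤ t) :
    y t = Real.exp (-(l * t)) * y₀ +
      (b t - l * ∫ s in (0 : ℝ)..t, Real.exp (-(l * (t - s))) * b s) := by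
  have hE : ∀ s, HasDerivAt (fun s => Real.exp (l * s)) (Real.exp (l * s) * l) s := fun s =>
    ((hasDerivAt_id s).const_mul l).exp.congr_deriv (by simp)
  have hu : ∀ s, HasDerivAt (fun s => ∫ r in (0 : ℝ)..s, y r) (y s) s := fun s =>
    intervalIntegral.integral_hasDerivAt_right (hy.intervalIntegrable _ _)
      hy.aestronglyMeasurable.stronglyMeasurableAtFilter hy.continuousAt
  -- With `u = ∫ y`, the equation is `u' + l u = y₀ + b`; `exp (l s)` is its integrating factor.
  -- Only `u`, not `y`, is differentiated.
  have h1 : ∫ s in (0 : ℝ)..t, Real.exp (l * s) * (y₀ + b s) =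
      Real.exp (l * t) * ∫ s in (0 : ℝ)..t, y s := by
    rw [intervalIntegral.integral_eq_sub_of_hasDerivAt
      (f := fun s => Real.exp (l * s) * ∫ r in (0 : ℝ)..s, y r)]
    · simp
    · intro s hs
      rw [Set.uIcc_of_le ht] at hs
      refine ((hE s).mul (hu s)).congr_deriv ?_
      rw [h s hs.1]
      ring
    · exact Continuous.intervalIntegrable (by fun_prop) _ _
  have h2 : l * ∫ s in (0 : ℝ)..t, Real.exp (l * s) = Real.exp (l * t) - 1 := by
    rw [← intervalIntegral.integral_const_mul, intervalIntegral.integral_eq_sub_of_hasDerivAt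
      (f := fun s => Real.exp (l * s))]
    · simp
    · intro s _
      exact (hE s).congr_deriv (mul_comm _ _)
    · exact Continuous.intervalIntegrable (by fun_prop) _ _
  have h3 : ∫ s in (0 : ℝ)..t, Real.exp (-(l * (t - s))) * b s =
      Real.exp (-(l * t)) * ∫ s in (0 : ℝ)..t, Real.exp (l * s) * b s := by
    rw [← intervalIntegral.integral_const_mul]
    refine intervalIntegral.integral_congr fun s _ => ?_
    rw [← mul_assoc, ← Real.exp_add]
    ring_nf
  have h4 : ∫ s in (0 : ℝ)..t, Real.exp (l * s) * (y₀ + b s) =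
      y₀ * (∫ s in (0 : ℝ)..t, Real.exp (l * s)) + ∫ s in (0 : ℝ)..t, Real.exp (l * s) * b s := by
    rw [← intervalIntegral.integral_const_mul, ← intervalIntegral.integral_add]
    · exact intervalIntegral.integral_congr fun s _ => by ring
    · exact Continuous.intervalIntegrable (by fun_prop) _ _
    · exact Continuous.intervalIntegrable (by fun_prop) _ _
  have h5 : Real.exp (-(l * t)) * Real.exp (l * t) = 1 := by
    rw [← Real.exp_add]; simp
  rw [h t ht, h3]
  linear_combination (-(l * ∫ s in (0 : ℝ)..t, y s) + y₀) * (-h5) + l * Real.exp (-(l * t)) * h1 -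
    l * Real.exp (-(l * t)) * h4 - y₀ * Real.exp (-(l * t)) * h2

lemma hasDerivAt_exp_neg_mul_sub (l t s : ℝ) :
    HasDerivAt (fun s => Real.exp (-(l * (t - s)))) (l * Real.exp (-(l * (t - s)))) s :=
  ((((hasDerivAt_id s).const_sub t).const_mul l).neg.exp).congr_deriv (by simp [mul_comm])

/-- The left side is the covariance of Brownian motion at time `s` with the Ornstein-Uhlenbeck
process at time `t`; the integral is split at `r = s`, where the minimum changes form. -/
lemma sub_integral_exp_mul_min {l s t : ℝ} (hl : l ≠ 0) (hs : 0 ≤ s) (hst : s ≤ t) :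
    s - l * ∫ r in (0 : ℝ)..t, Real.exp (-(l * (t - r))) * min r s =
      (Real.exp (-(l * (t - s))) - Real.exp (-(l * t))) / l := by
  have hi : ∀ a b, IntervalIntegrable (fun r => Real.exp (-(l * (t - r))) * min r s) volume a b :=
    fun a b => Continuous.intervalIntegrable (by fun_prop) _ _
  rw [← intervalIntegral.integral_add_adjacent_intervals (hi 0 s) (hi s t)]
  have h1 : ∫ r in (0 : ℝ)..s, Real.exp (-(l * (t - r))) * min r s =
      Real.exp (-(l * (t - s))) * (s / l - 1 / l ^ 2) + Real.exp (-(l * t)) / l ^ 2 := by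
    rw [intervalIntegral.integral_congr (g := fun r => Real.exp (-(l * (t - r))) * r),
      intervalIntegral.integral_eq_sub_of_hasDerivAt
        (f := fun r => Real.exp (-(l * (t - r))) * (r / l - 1 / l ^ 2))]
    · simp; ring
    · intro r _
      refine ((hasDerivAt_exp_neg_mul_sub l t r).mul
        (((hasDerivAt_id r).div_const l).sub_const (1 / l ^ 2))).congr_deriv ?_
      simp only [id]
      field_simp
      ring
    · exact Continuous.intervalIntegrable (by fun_prop) _ _
    · intro r hr
      rw [Set.uIcc_of_le hs] at hr
      simp [min_eq_left hr.2]
  have h2 : ∫ r in s..t, Real.exp (-(l * (t - r))) * min r s =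
      s * (1 - Real.exp (-(l * (t - s)))) / l := by
    rw [intervalIntegral.integral_congr (g := fun r => Real.exp (-(l * (t - r))) * s),
      intervalIntegral.integral_eq_sub_of_hasDerivAt
        (f := fun r => Real.exp (-(l * (t - r))) * (s / l))]
    · simp; ring
    · intro r _
      refine ((hasDerivAt_exp_neg_mul_sub l t r).mul_const (s / l)).congr_deriv ?_
      field_simp
    · exact Continuous.intervalIntegrable (by fun_prop) _ _
    · intro r hr
      rw [Set.uIcc_of_le hst] at hr
      simp [min_eq_right hr.1]
  rw [h1, h2]
  field_simp
  ring

/-- Feeds the preceding covariance back into the formula for the process, giving its variance; `exp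
0` is the factor at `s = t`. -/
lemma integral_exp_mul_exp_sub {l t : ℝ} (hl : l ≠ 0) :
    (Real.exp 0 - Real.exp (-(l * t))) / l - l * ∫ s in (0 : ℝ)..t, Real.exp (-(l * (t - s))) *
      ((Real.exp (-(l * (t - s))) - Real.exp (-(l * t))) / l) =
      (1 - Real.exp (-(2 * l * t))) / (2 * l) := by
  rw [intervalIntegral.integral_eq_sub_of_hasDerivAt
    (f := fun s => Real.exp (-(l * (t - s))) ^ 2 / (2 * l ^ 2) -
      Real.exp (-(l * (t - s))) * (Real.exp (-(l * t)) / l ^ 2))]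
  · have : Real.exp (-(2 * l * t)) = Real.exp (-(l * t)) ^ 2 := by
      rw [sq, ← Real.exp_add]; ring_nf
    rw [this]
    simp only [sub_self, mul_zero, neg_zero, Real.exp_zero, sub_zero]
    field_simp
    ring
  · intro s _
    refine ((((hasDerivAt_exp_neg_mul_sub l t s).pow 2).div_const _).sub
      ((hasDerivAt_exp_neg_mul_sub l t s).mul_const _)).congr_deriv ?_
    field_simp
    ring
  · exact Continuous.intervalIntegrable (by fun_prop) _ _

end LinearEquation

/-! ### Covariances of Ornstein-Uhlenbeck processes. -/

section OrnsteinUhlenbeck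

variable {Ω : Type*} [MeasurableSpace Ω] {P : Measure Ω}

/-- The solution, started at `0`, of the Langevin equation `dy = -l y dt + dB`. -/
noncomputable def ouNoise (l : ℝ) (B : ℝ → Ω → ℝ) (t : ℝ) (ω : Ω) : ℝ :=
  B t ω - l * ∫ s in (0 : ℝ)..t, Real.exp (-(l * (t - s))) * B s ω

lemma memLp_exp_mul {B : ℝ → Ω → ℝ} {t : ℝ}
    (hBu : MemLp (Function.uncurry B) 2 ((volume.restrict (Set.Ioc 0 t)).prod P)) [SFinite P]
    (l : ℝ) :
    MemLp (Function.uncurry fun s ω => Real.exp (-(l * (t - s))) * B s ω) 2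
      ((volume.restrict (Set.Ioc 0 t)).prod P) := by
  refine MemLp.of_le_mul (c := Real.exp (|l| * t)) hBu ?_ ?_
  · refine AEStronglyMeasurable.mul (f := fun z : ℝ × Ω => Real.exp (-(l * (t - z.1)))) ?_ hBu.1
    exact (Continuous.measurable (f := fun s : ℝ => Real.exp (-(l * (t - s)))) (by fun_prop)).comp
      measurable_fst |>.aestronglyMeasurable
  · have := (Measure.quasiMeasurePreserving_fst (μ := volume.restrict (Set.Ioc 0 t))
      (ν := P)).ae (ae_restrict_mem measurableSet_Ioc)
    filter_upwards [this] with z hz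
    simp only [Function.uncurry, norm_mul, Real.norm_eq_abs, Real.abs_exp]
    gcongr
    calc -(l * (t - z.1)) ≤ |l| * (t - z.1) := by
          rw [← neg_mul]
          exact mul_le_mul_of_nonneg_right (neg_le_abs l) (by linarith [hz.2])
      _ ≤ |l| * t := by
          gcongr
          linarith [hz.1]

variable [IsProbabilityMeasure P] {B : ℝ → Ω → ℝ} {t : ℝ}

lemma memLp_ouNoise (hB : MemLp (B t) 2 P)
    (hBu : MemLp (Function.uncurry B) 2 ((volume.restrict (Set.Ioc 0 t)).prod P)) (ht : 0 ≤ t)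
    (l : ℝ) : MemLp (ouNoise l B t) 2 P := by
  refine hB.sub (MemLp.const_mul ?_ l)
  simp only [intervalIntegral.integral_of_le ht]
  exact memLp_two_integral (memLp_exp_mul hBu l)

/-- Fubini moves the covariance inside the time integral. Applied in both arguments, it reduces
every covariance below to those of `B`. -/
lemma covariance_ouNoise_left (hB : ∀ s, MemLp (B s) 2 P)
    (hBu : MemLp (Function.uncurry B) 2 ((volume.restrict (Set.Ioc 0 t)).prod P)) (ht : 0 ≤ t)
    (l : ℝ) {Y : Ω → ℝ} (hY : MemLp Y 2 P) :
    cov[ouNoise l B t, Y; P] =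
      cov[B t, Y; P] - l * ∫ s in (0 : ℝ)..t, Real.exp (-(l * (t - s))) * cov[B s, Y; P] := by
  have h1 : MemLp (fun ω => ∫ s in (0 : ℝ)..t, Real.exp (-(l * (t - s))) * B s ω) 2 P := by
    simp only [intervalIntegral.integral_of_le ht]
    exact memLp_two_integral (memLp_exp_mul hBu l)
  have h2 : ouNoise l B t =
      B t - fun ω => l * ∫ s in (0 : ℝ)..t, Real.exp (-(l * (t - s))) * B s ω := rfl
  rw [h2, covariance_sub_left (hB t) (h1.const_mul l) hY, covariance_const_mul_left]
  simp only [intervalIntegral.integral_of_le ht]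
  rw [covariance_integral_left (memLp_exp_mul hBu l)
    (Eventually.of_forall fun s => (hB s).const_mul _) hY]
  simp only [covariance_const_mul_left]

lemma covariance_ouNoise_eq_zero (hB : ∀ s, MemLp (B s) 2 P)
    (hBu : MemLp (Function.uncurry B) 2 ((volume.restrict (Set.Ioc 0 t)).prod P)) (ht : 0 ≤ t)
    (l : ℝ) {Y : Ω → ℝ} (hY : MemLp Y 2 P) (hcov : ∀ s, 0 ≤ s → cov[B s, Y; P] = 0) :
    cov[ouNoise l B t, Y; P] = 0 := by
  rw [covariance_ouNoise_left hB hBu ht l hY, hcov t ht, zero_sub, neg_eq_zero,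
    intervalIntegral.integral_congr (g := fun _ => 0), intervalIntegral.integral_zero, mul_zero]
  intro s hs
  rw [Set.uIcc_of_le ht] at hs
  simp [hcov s hs.1]

lemma covariance_ouNoise_self (hB : ∀ s, MemLp (B s) 2 P)
    (hBu : MemLp (Function.uncurry B) 2 ((volume.restrict (Set.Ioc 0 t)).prod P)) (ht : 0 ≤ t)
    {l : ℝ} (hl : l ≠ 0) (hcov : ∀ s r, 0 ≤ s → 0 ≤ r → cov[B s, B r; P] = min s r) :
    cov[ouNoise l B t, ouNoise l B t; P] = (1 - Real.exp (-(2 * l * t))) / (2 * l) := by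
  have h1 : ∀ s ∈ Set.Icc 0 t, cov[B s, ouNoise l B t; P] =
      (Real.exp (-(l * (t - s))) - Real.exp (-(l * t))) / l := by
    intro s hs
    rw [covariance_comm, covariance_ouNoise_left hB hBu ht l (hB s), hcov t s ht hs.1,
      min_eq_right hs.2, ← sub_integral_exp_mul_min hl hs.1 hs.2]
    congr 2
    refine intervalIntegral.integral_congr fun r hr => ?_
    rw [Set.uIcc_of_le ht] at hr
    rw [hcov r s hr.1 hs.1]
  rw [covariance_ouNoise_left hB hBu ht l (memLp_ouNoise (hB t) hBu ht l), h1 t ⟨ht, le_rfl⟩,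
    ← integral_exp_mul_exp_sub hl]
  congr 2
  · simp
  · refine intervalIntegral.integral_congr fun s hs => ?_
    rw [Set.uIcc_of_le ht] at hs
    simp only [h1 s hs]

end OrnsteinUhlenbeck

/-! ### Mode decomposition and the steady-state variance. -/

section ConsensusVariance

lemma exists_orthogonal_diagonalization {V : Type*} [Fintype V] [DecidableEq V]
    {A : Matrix V V ℝ} (hA : A.PosSemidef) :
    ∃ (U : Matrix V V ℝ) (l : V → ℝ), Uᵀ * U = 1 ∧ U * Uᵀ = 1 ∧
      Uᵀ * A = Matrix.diagonal l * Uᵀ ∧ ∀ a, 0 ≤ l a := by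
  set U : Matrix V V ℝ := hA.1.eigenvectorUnitary.1 with hU
  have h1 : Uᵀ * U = 1 := by
    have := Unitary.coe_star_mul_self hA.1.eigenvectorUnitary
    rwa [Matrix.star_eq_conjTranspose, Matrix.conjTranspose_eq_transpose_of_trivial] at this
  refine ⟨U, hA.1.eigenvalues, h1, mul_eq_one_comm.1 h1, ?_, hA.eigenvalues_nonneg⟩
  have hAt : Aᵀ = A := by
    have := hA.1
    rwa [Matrix.IsHermitian, Matrix.conjTranspose_eq_transpose_of_trivial] at this
  ext a j
  have h2 := congrFun (hA.1.mulVec_eigenvectorBasis a) j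
  have h3 : (Uᵀ * A) a j = (A *ᵥ ⇑(hA.1.eigenvectorBasis a)) j := by
    rw [Matrix.mul_apply, Matrix.mulVec, dotProduct]
    refine Finset.sum_congr rfl fun i _ => ?_
    rw [show A j i = A i j from congrFun₂ hAt i j, mul_comm]
    rfl
  rw [h3, h2, Matrix.diagonal_mul]
  rfl

variable {V Ω : Type*} [Fintype V] [MeasurableSpace Ω] {G : SimpleGraph V} {P : Measure Ω}
  {W x : ℝ≥0 → Ω → V → ℝ} {U : Matrix V V ℝ}

/-- The coordinates of the noise in the basis of the columns of `U`. -/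
noncomputable def modeNoise (W : ℝ≥0 → Ω → V → ℝ) (U : Matrix V V ℝ) (a : V) (s : ℝ) (ω : Ω) : ℝ :=
  ∑ i, U i a * W s.toNNReal ω i

lemma memLp_modeNoise (hW : ∀ i, IsBrownianReal (fun t ω => W t ω i) P) (a : V) (s : ℝ) :
    MemLp (modeNoise W U a s) 2 P :=
  memLp_finsetSum (f := fun i ω => U i a * W s.toNNReal ω i) _ fun i _ =>
    ((hW i).memLp_eval s.toNNReal).const_mul _

lemma memLp_uncurry_modeNoise [IsProbabilityMeasure P]
    (hW : ∀ i, IsBrownianReal (fun t ω => W t ω i) P) (a : V) (t : ℝ) :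
    MemLp (Function.uncurry (modeNoise W U a)) 2 ((volume.restrict (Set.Ioc 0 t)).prod P) :=
  memLp_finsetSum (f := fun i (z : ℝ × Ω) => U i a * W z.1.toNNReal z.2 i) _ fun i _ =>
    ((hW i).memLp_uncurry t).const_mul _

/-- White noise is invariant under rotation at the level of second moments, and only second moments
are needed later. -/
lemma covariance_modeNoise [DecidableEq V] [IsProbabilityMeasure P]
    (hW : ∀ i, IsBrownianReal (fun t ω => W t ω i) P)
    (hind : iIndepFun (fun (i : V) (ω : Ω) (t : ℝ≥0) => W t ω i) P) (hU : Uᵀ * U = 1)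
    (a b : V) {s r : ℝ} (hs : 0 ≤ s) (hr : 0 ≤ r) :
    cov[modeNoise W U a s, modeNoise W U b r; P] = if a = b then min s r else 0 := by
  have hcov : ∀ i j, cov[fun ω => W s.toNNReal ω i, fun ω => W r.toNNReal ω j; P] =
      if i = j then min s r else 0 := by
    intro i j
    split_ifs with hij
    · subst hij
      rw [(hW i).covariance_fun_eval, NNReal.coe_min, Real.coe_toNNReal _ hs,
        Real.coe_toNNReal _ hr]
    · exact ((hind.indepFun hij).comp (φ := fun w : ℝ≥0 → ℝ => w s.toNNReal)
        (ψ := fun w : ℝ≥0 → ℝ => w r.toNNReal) (measurable_pi_apply _)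
        (measurable_pi_apply _)).covariance_eq_zero
        ((hW i).memLp_eval s.toNNReal) ((hW j).memLp_eval r.toNNReal)
  have hab := congrFun₂ hU a b
  rw [Matrix.mul_apply, Matrix.one_apply] at hab
  unfold modeNoise
  rw [covariance_fun_sum_fun_sum (fun i => ((hW i).memLp_eval _).const_mul _)
    (fun j => ((hW j).memLp_eval _).const_mul _)]
  simp only [covariance_const_mul_left, covariance_const_mul_right, hcov, mul_ite, mul_zero,
    Finset.sum_ite_eq, Finset.mem_univ, if_true]
  rw [Finset.sum_congr rfl fun i _ => show U i b * (U i a * min s r) =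
    Uᵀ a i * U i b * min s r by rw [Matrix.transpose_apply]; ring, ← Finset.sum_mul, hab]
  split_ifs <;> simp

lemma covariance_ouNoise_modeNoise [DecidableEq V] [IsProbabilityMeasure P]
    (hW : ∀ i, IsBrownianReal (fun t ω => W t ω i) P)
    (hind : iIndepFun (fun (i : V) (ω : Ω) (t : ℝ≥0) => W t ω i) P) (hU : Uᵀ * U = 1)
    (l : V → ℝ) {a b : V} (hab : a ≠ b) {t : ℝ} (ht : 0 ≤ t) :
    cov[ouNoise (l a) (modeNoise W U a) t, ouNoise (l b) (modeNoise W U b) t; P] = 0 := by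
  have hm := fun a s => memLp_modeNoise (U := U) hW a s
  have hu := fun a => memLp_uncurry_modeNoise (U := U) hW a t
  refine covariance_ouNoise_eq_zero (hm a) (hu a) ht _ (memLp_ouNoise (hm b t) (hu b) ht _)
    fun s hs => ?_
  rw [covariance_comm]
  refine covariance_ouNoise_eq_zero (hm b) (hu b) ht _ (hm a s) fun r hr => ?_
  rw [covariance_modeNoise hW hind hU b a hr hs, if_neg hab.symm]

open Classical in
/-- The modes of the noisy consensus dynamics are Ornstein-Uhlenbeck processes. -/
lemma IsNoisyConsensus.mode_ae_eq (h : IsNoisyConsensus G P W x) {l : V → ℝ}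
    (hL : Uᵀ * G.lapMatrix ℝ = Matrix.diagonal l * Uᵀ) :
    ∀ᵐ ω ∂P, ∀ (t : ℝ≥0) (a : V), (Uᵀ *ᵥ x t ω) a =
      Real.exp (-(l a * t)) * (Uᵀ *ᵥ x 0 ω) a + ouNoise (l a) (modeNoise W U a) t ω := by
  have hc : ∀ᵐ ω ∂P, ∀ i, Continuous fun t => W t ω i := ae_all_iff.2 fun i => (h.brownian i).cont
  filter_upwards [hc, h.continuous_paths, h.solution] with ω hW hx hsol t a
  have hx' : Continuous fun s : ℝ => x s.toNNReal ω := hx.comp continuous_real_toNNReal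
  have hW' : ∀ i, Continuous fun s : ℝ => W s.toNNReal ω i := fun i =>
    (hW i).comp continuous_real_toNNReal
  have hy : ∀ M : Matrix V V ℝ, ∀ j, Continuous fun s : ℝ => (M *ᵥ x s.toNNReal ω) j := fun M j =>
    (continuous_apply j).comp (continuous_const.matrix_mulVec hx')
  have hb : Continuous fun s : ℝ => modeNoise W U a s ω :=
    continuous_finsetSum _ fun i _ => continuous_const.mul (hW' i)
  have key := eq_exp_mul_add_of_integral_eq (hy Uᵀ a) hb (l := l a) (y₀ := (Uᵀ *ᵥ x 0 ω) a)
    (fun t ht => ?_) t.2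
  · simpa [ouNoise] using key
  have h1 : ∀ s : ℝ, l a * (Uᵀ *ᵥ x s.toNNReal ω) a =
      ∑ j, U j a * (G.lapMatrix ℝ *ᵥ x s.toNNReal ω) j := by
    intro s
    have : (Uᵀ *ᵥ (G.lapMatrix ℝ *ᵥ x s.toNNReal ω)) a = l a * (Uᵀ *ᵥ x s.toNNReal ω) a := by
      rw [Matrix.mulVec_mulVec, hL, ← Matrix.mulVec_mulVec, Matrix.mulVec_diagonal]
    rw [← this]
    rfl
  have h2 : l a * ∫ s in (0 : ℝ)..t, (Uᵀ *ᵥ x s.toNNReal ω) a =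
      ∑ j, U j a * ∫ s in (0 : ℝ)..t, (G.lapMatrix ℝ *ᵥ x s.toNNReal ω) j := by
    rw [← intervalIntegral.integral_const_mul]
    simp only [h1]
    rw [intervalIntegral.integral_finsetSum]
    · simp only [intervalIntegral.integral_const_mul]
    · exact fun j _ => (continuous_const.mul (hy _ j)).intervalIntegrable _ _
  have h3 : (Uᵀ *ᵥ x t.toNNReal ω) a = ∑ j, U j a * x t.toNNReal ω j := rfl
  have h4 : (Uᵀ *ᵥ x 0 ω) a = ∑ j, U j a * x 0 ω j := rfl
  rw [h2, h3, h4, modeNoise, ← Finset.sum_sub_distrib, ← Finset.sum_add_distrib]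
  refine Finset.sum_congr rfl fun j _ => ?_
  rw [hsol t.toNNReal j, Real.coe_toNNReal t ht, intervalIntegral.integral_neg]
  ring

open Classical in
/-- The steady-state variance of the deviation at `i` is half the `i`-th diagonal entry of the
pseudo-inverse `M` of the Laplacian. -/
theorem IsNoisyConsensus.tendsto_variance_deviation [IsProbabilityMeasure P]
    (h : IsNoisyConsensus G P W x) {M : Matrix V V ℝ} (hM : Mᵀ = M)
    (hLM : G.lapMatrix ℝ * M = 1 - (1 / (Fintype.card V : ℝ)) • onesMatrix V)
    (hMJ : M * onesMatrix V = 0) (i : V) :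
    (∀ t, MemLp (deviation x i t) 2 P) ∧
      Tendsto (fun t => variance (deviation x i t) P) atTop (𝓝 (M i i / 2)) := by
  obtain ⟨U, l, hU, hU', hUL, hl⟩ := exists_orthogonal_diagonalization (G.posSemidef_lapMatrix ℝ)
  set Q : Matrix V V ℝ := 1 - (1 / (Fintype.card V : ℝ)) • onesMatrix V with hQ
  have hQt : Qᵀ = Q := by simp [hQ, onesMatrix_transpose]
  have hML : M * G.lapMatrix ℝ = Q := by
    rw [← hQt, ← hLM, Matrix.transpose_mul, hM, (G.isSymm_lapMatrix ℝ).eq]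
  have hLU : G.lapMatrix ℝ * U = U * Matrix.diagonal l := by
    have := congrArg Matrix.transpose hUL
    simpa [Matrix.transpose_mul, (G.isSymm_lapMatrix ℝ).eq] using this
  -- The coefficient of a mode in the deviation carries a factor `l a`, so zero modes drop out;
  -- connectedness of the graph is never invoked.
  have hC : ∀ a, (Q * U) i a = (M * U) i a * l a := by
    intro a
    rw [← hML, Matrix.mul_assoc, hLU, ← Matrix.mul_assoc, Matrix.mul_diagonal]
  have hdev : ∀ t ω, deviation x i t ω = ∑ a, (Q * U) i a * (Uᵀ *ᵥ x t ω) a := by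
    intro t ω
    have h1 : ∑ a, (Q * U) i a * (Uᵀ *ᵥ x t ω) a = (Q *ᵥ x t ω) i := by
      have : Q *ᵥ x t ω = (Q * U) *ᵥ (Uᵀ *ᵥ x t ω) := by
        rw [Matrix.mulVec_mulVec, Matrix.mul_assoc, hU', Matrix.mul_one]
      rw [this]
      rfl
    rw [h1, hQ, Matrix.sub_mulVec, Matrix.smul_mulVec, Matrix.one_mulVec]
    simp [deviation, onesMatrix, Matrix.mulVec, dotProduct]
  have hW := h.brownian
  have hm := fun a s => memLp_modeNoise (U := U) hW a s
  have hu := fun a t => memLp_uncurry_modeNoise (U := U) hW a t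
  have hI : ∀ (t : ℝ≥0) a, MemLp (ouNoise (l a) (modeNoise W U a) t) 2 P := fun t a =>
    memLp_ouNoise (hm a t) (hu a t) t.2 _
  have hZ : ∀ a, MemLp (fun ω => (Uᵀ *ᵥ x 0 ω) a) 2 P := fun a =>
    memLp_finsetSum (f := fun j ω => U j a * x 0 ω j) _ fun j _ => (h.initial_memLp j).const_mul _
  have hZI : ∀ (t : ℝ≥0) a b,
      cov[fun ω => (Uᵀ *ᵥ x 0 ω) a, ouNoise (l b) (modeNoise W U b) t; P] = 0 := by
    intro t a b
    rw [covariance_comm]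
    refine covariance_ouNoise_eq_zero (hm b) (hu b t) t.2 _ (hZ a) fun s _ => ?_
    rw [covariance_comm]
    have hφ : Measurable fun v : V → ℝ => (Uᵀ *ᵥ v) a := by
      unfold Matrix.mulVec dotProduct
      fun_prop
    have hψ : Measurable fun w : ℝ≥0 → V → ℝ => ∑ i, U i b * w s.toNNReal i := by fun_prop
    exact (h.initial_indep.comp hφ hψ).covariance_eq_zero (hZ a) (hm b s)
  -- The deviation splits into the decaying initial state `A` and the accumulated noise `N`, which
  -- are uncorrelated.
  set A : ℝ≥0 → Ω → ℝ := fun t ω =>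
    ∑ a, ((Q * U) i a * Real.exp (-(l a * t))) * (Uᵀ *ᵥ x 0 ω) a with hA
  set N : ℝ≥0 → Ω → ℝ := fun t ω =>
    ∑ a, (Q * U) i a * ouNoise (l a) (modeNoise W U a) t ω with hN
  have hA2 : ∀ t, MemLp (A t) 2 P := fun t => memLp_finsetSum
    (f := fun a ω => ((Q * U) i a * Real.exp (-(l a * t))) * (Uᵀ *ᵥ x 0 ω) a) _
    fun a _ => (hZ a).const_mul _
  have hN2 : ∀ t, MemLp (N t) 2 P := fun t => memLp_finsetSum
    (f := fun a ω => (Q * U) i a * ouNoise (l a) (modeNoise W U a) t ω) _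
    fun a _ => (hI t a).const_mul _
  have hae : ∀ t, deviation x i t =ᵐ[P] A t + N t := by
    intro t
    filter_upwards [h.mode_ae_eq hUL] with ω hω
    rw [hdev]
    simp only [Pi.add_apply, hA, hN, ← Finset.sum_add_distrib]
    exact Finset.sum_congr rfl fun a _ => by rw [hω t a]; ring
  have hAA : ∀ t, cov[A t, A t; P] = ∑ a, ∑ b, ((Q * U) i a * Real.exp (-(l a * t))) *
      (((Q * U) i b * Real.exp (-(l b * t))) *
        cov[fun ω => (Uᵀ *ᵥ x 0 ω) a, fun ω => (Uᵀ *ᵥ x 0 ω) b; P]) := by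
    intro t
    simp only [hA]
    rw [covariance_fun_sum_fun_sum (fun a => (hZ a).const_mul _) fun a => (hZ a).const_mul _]
    simp only [covariance_const_mul_left, covariance_const_mul_right]
    exact Finset.sum_congr rfl fun a _ => Finset.sum_congr rfl fun b _ => by ring
  have hAN : ∀ t, cov[A t, N t; P] = 0 := by
    intro t
    simp only [hA, hN]
    rw [covariance_fun_sum_fun_sum (fun a => (hZ a).const_mul _) fun a => (hI t a).const_mul _]
    simp only [covariance_const_mul_left, covariance_const_mul_right]
    refine Finset.sum_eq_zero fun a _ => Finset.sum_eq_zero fun b _ => ?_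
    rw [show cov[fun ω => (Uᵀ *ᵥ x 0 ω) a,
      fun ω => ouNoise (l b) (modeNoise W U b) t ω; P] = 0 from hZI t a b]
    simp
  have hNN : ∀ t : ℝ≥0, cov[N t, N t; P] =
      ∑ a, (Q * U) i a * (M * U) i a * (1 - Real.exp (-(2 * l a * t))) / 2 := by
    intro t
    simp only [hN]
    rw [covariance_fun_sum_fun_sum (fun a => (hI t a).const_mul _) fun a => (hI t a).const_mul _]
    simp only [covariance_const_mul_left, covariance_const_mul_right]
    refine Finset.sum_congr rfl fun a _ => ?_
    rw [Finset.sum_eq_single a]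
    -- The variance formula divides by `l a`; at `l a = 0` the coefficient vanishes, and otherwise
    -- `hC` absorbs the division into `M * U`.
    · by_cases hla : l a = 0
      · simp [hC, hla]
      · rw [show cov[fun ω => ouNoise (l a) (modeNoise W U a) t ω,
          fun ω => ouNoise (l a) (modeNoise W U a) t ω; P] = _ from
          covariance_ouNoise_self (hm a) (hu a t) t.2 hla fun s r hs hr => by
            rw [covariance_modeNoise hW h.noise_indep hU a a hs hr, if_pos rfl], hC]
        field_simp
    · intro b _ hb
      rw [show cov[fun ω => ouNoise (l a) (modeNoise W U a) t ω,
          fun ω => ouNoise (l b) (modeNoise W U b) t ω; P] = 0 from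
          covariance_ouNoise_modeNoise hW h.noise_indep hU l hb.symm t.2]
      simp
    · simp
  have hvar : ∀ t, variance (deviation x i t) P = cov[A t, A t; P] + cov[N t, N t; P] := by
    intro t
    rw [variance_congr (hae t), variance_add (hA2 t) (hN2 t), hAN, mul_zero, add_zero,
      covariance_self (hA2 t).aemeasurable, covariance_self (hN2 t).aemeasurable]
  have hexp : ∀ c : ℝ, 0 < c → Tendsto (fun t : ℝ≥0 => Real.exp (-(c * t))) atTop (𝓝 0) :=
    fun c hc => Real.tendsto_exp_neg_atTop_nhds_zero.comp
      ((NNReal.tendsto_coe_atTop.2 tendsto_id).const_mul_atTop hc)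
  refine ⟨fun t => ((hA2 t).add (hN2 t)).ae_eq (hae t).symm, ?_⟩
  simp only [hvar, hAA, hNN]
  have hlim0 : ∀ a, Tendsto (fun t : ℝ≥0 => (Q * U) i a * Real.exp (-(l a * t))) atTop (𝓝 0) := by
    intro a
    rcases (hl a).eq_or_lt with h0 | h0
    · simp [hC, ← h0]
    · simpa using (hexp _ h0).const_mul ((Q * U) i a)
  have hlim1 : ∀ a, Tendsto (fun t : ℝ≥0 =>
      (Q * U) i a * (M * U) i a * (1 - Real.exp (-(2 * l a * t))) / 2) atTop
      (𝓝 ((Q * U) i a * (M * U) i a / 2)) := by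
    intro a
    rcases (hl a).eq_or_lt with h0 | h0
    · simp [hC, ← h0]
    · simpa using (((hexp (2 * l a) (by positivity)).const_sub 1).const_mul
        ((Q * U) i a * (M * U) i a)).div_const 2
  have hsum : M i i / 2 = 0 + ∑ a, (Q * U) i a * (M * U) i a / 2 := by
    -- The product collapses to `Q * M`, and `Q` fixes `M` since the columns of `M` sum to zero.
    have h1 : (Q * U) * (M * U)ᵀ = M := by
      have hJM : onesMatrix V * M = 0 := by
        have := congrArg Matrix.transpose hMJ
        simpa [Matrix.transpose_mul, hM, onesMatrix_transpose] using this
      rw [Matrix.transpose_mul, hM, Matrix.mul_assoc, ← Matrix.mul_assoc U, hU', Matrix.one_mul,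
        hQ, Matrix.sub_mul, Matrix.smul_mul, hJM, smul_zero, sub_zero, Matrix.one_mul]
    have h2 := congrFun₂ h1 i i
    rw [Matrix.mul_apply] at h2
    rw [← Finset.sum_div, zero_add, ← h2]
    rfl
  rw [hsum]
  refine Tendsto.add ?_ (tendsto_finsetSum _ fun a _ => hlim1 a)
  rw [show (0 : ℝ) = ∑ a : V, ∑ b : V, (0 : ℝ) * (0 *
    cov[fun ω => (Uᵀ *ᵥ x 0 ω) a, fun ω => (Uᵀ *ᵥ x 0 ω) b; P]) by simp]
  exact tendsto_finsetSum _ fun a _ => tendsto_finsetSum _ fun b _ =>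
    (hlim0 a).mul ((hlim0 b).mul_const _)

end ConsensusVariance

theorem firstOrderCoherence_sierpinskiGraph {n k : ℕ} (hk : 0 < k) {Ω : Type*} [MeasurableSpace Ω]
    {P : Measure Ω} [IsProbabilityMeasure P] {W x : ℝ≥0 → Ω → (Fin n → Fin k) → ℝ}
    (h : IsNoisyConsensus (sierpinskiGraph n k) P W x) :
    (∀ p t, MemLp (deviation x p t) 2 P) ∧
      (∀ p, ∃ v : ℝ, Tendsto (fun t => variance (deviation x p t) P) atTop (𝓝 v)) ∧
      firstOrderCoherence P x =
        (((k : ℝ) ^ 2 + k + 2) * (k - 1) * (k + 2) ^ n - 4 * k) /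
            (4 * k ^ (n + 1) * (k + 1) * (k + 2)) -
          ((k : ℝ) - 2) * (k + 1) / (4 * k * (k + 2)) := by
  classical
  obtain ⟨M, hM, hLM, hMJ, htr⟩ := exists_sierpinskiGraph_green hk n
  have hcard : (Fintype.card (Fin n → Fin k) : ℝ) = (k : ℝ) ^ n := by simp
  rw [← hcard] at hLM
  have key := fun p => h.tendsto_variance_deviation hM (by convert hLM) hMJ p
  have hk' : (0 : ℝ) < k := by exact_mod_cast hk
  refine ⟨fun p => (key p).1, fun p => ⟨_, (key p).2⟩, ?_⟩
  -- The mean of the limits is the trace over `2 k^n`, the factor built into `greenTrace`.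
  rw [firstOrderCoherence, Finset.sum_congr rfl fun p _ => (key p).2.limUnder_eq,
    ← Finset.sum_div, show ∑ p, M p p = M.trace from rfl, htr, hcard, greenTrace]
  field_simp

/-- The power of the number of vertices is `((k+2)/k)^n`, and `k³ + k - 2 = (k² + k + 2)(k - 1)`
matches the leading coefficient. After division, the two remaining terms decay like `(k+2)^(-n)` and
`(k/(k+2))^n`. -/
lemma isEquivalent_coherence_formula {k : ℕ} (hk : 3 ≤ k) :
    Asymptotics.IsEquivalent atTop
      (fun n : ℕ => (((k : ℝ) ^ 2 + k + 2) * (k - 1) * (k + 2) ^ n - 4 * k) /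
            (4 * k ^ (n + 1) * (k + 1) * (k + 2)) -
          ((k : ℝ) - 2) * (k + 1) / (4 * k * (k + 2)))
      (fun n : ℕ => ((k : ℝ) ^ 3 + k - 2) / (4 * k * (k + 1) * (k + 2)) *
        (Fintype.card (Fin n → Fin k) : ℝ) ^
          (Real.log ((k : ℝ) + 2) / Real.log (k : ℝ) - 1)) := by
  have hk3 : (3 : ℝ) ≤ k := by exact_mod_cast hk
  have hk0 : (0 : ℝ) < k := by linarith
  have hlog : 0 < Real.log k := Real.log_pos (by linarith)
  set C : ℝ := ((k : ℝ) ^ 3 + k - 2) / (4 * k * (k + 1) * (k + 2)) with hC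
  have hC0 : 0 < C := by
    refine div_pos ?_ (by positivity)
    nlinarith [pow_pos hk0 3]
  have hpow : ∀ n : ℕ, (Fintype.card (Fin n → Fin k) : ℝ) ^
      (Real.log ((k : ℝ) + 2) / Real.log (k : ℝ) - 1) = (((k : ℝ) + 2) / k) ^ n := by
    intro n
    have h1 : (k : ℝ) ^ (Real.log ((k : ℝ) + 2) / Real.log (k : ℝ) - 1) = ((k : ℝ) + 2) / k := by
      rw [Real.rpow_sub_one hk0.ne', Real.rpow_def_of_pos hk0, mul_div_cancel₀ _ hlog.ne',
        Real.exp_log (by linarith)]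
    rw [Fintype.card_fun, Fintype.card_fin, Fintype.card_fin, Nat.cast_pow, ← Real.rpow_natCast,
      ← Real.rpow_mul hk0.le, mul_comm, Real.rpow_mul hk0.le, h1, Real.rpow_natCast]
  simp only [hpow]
  have hr : Tendsto (fun n : ℕ => ((k : ℝ) / (k + 2)) ^ n) atTop (𝓝 0) :=
    tendsto_pow_atTop_nhds_zero_of_lt_one (by positivity) (by rw [div_lt_one] <;> linarith)
  have hr' : Tendsto (fun n : ℕ => (1 / ((k : ℝ) + 2)) ^ n) atTop (𝓝 0) :=
    tendsto_pow_atTop_nhds_zero_of_lt_one (by positivity) (by rw [div_lt_one] <;> linarith)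
  rw [Asymptotics.isEquivalent_iff_tendsto_one (Eventually.of_forall fun n => by positivity)]
  have h1 : Tendsto (fun n : ℕ => 1 - 1 / ((k + 1) * (k + 2)) / C * (1 / ((k : ℝ) + 2)) ^ n -
      ((k : ℝ) - 2) * (k + 1) / (4 * k * (k + 2)) / C * ((k : ℝ) / (k + 2)) ^ n) atTop
      (𝓝 (1 - 1 / ((k + 1) * (k + 2)) / C * 0 -
        ((k : ℝ) - 2) * (k + 1) / (4 * k * (k + 2)) / C * 0)) :=
    ((hr'.const_mul _).const_sub 1).sub (hr.const_mul _)
  simp only [mul_zero, sub_zero] at h1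
  refine h1.congr fun n => ?_
  have h2 : (k : ℝ) ^ 3 + k - 2 = C * (4 * k * (k + 1) * (k + 2)) := by
    rw [hC]; field_simp
  have h3 : ((k : ℝ) ^ 2 + k + 2) * (k - 1) = C * (4 * k * (k + 1) * (k + 2)) := by
    rw [← h2]; ring
  simp only [Pi.div_apply, h3]
  clear_value C
  simp only [div_pow, one_pow]
  field_simp
  ring

theorem theorem4 (k : ℕ) (hk : 3 ≤ k) :
    (∀ (n : ℕ), 1 ≤ n → ∀ (Ω : Type*) [MeasurableSpace Ω] (P : Measure Ω) [IsProbabilityMeasure P]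
      (W x : ℝ≥0 → Ω → (Fin n → Fin k) → ℝ), IsNoisyConsensus (sierpinskiGraph n k) P W x →
        (∀ p t, MemLp (deviation x p t) 2 P) ∧
        (∀ p, ∃ v : ℝ, Tendsto (fun t => variance (deviation x p t) P) atTop (𝓝 v)) ∧
        firstOrderCoherence P x =
          (((k : ℝ) ^ 2 + k + 2) * (k - 1) * (k + 2) ^ n - 4 * k) /
              (4 * k ^ (n + 1) * (k + 1) * (k + 2)) -
            ((k : ℝ) - 2) * (k + 1) / (4 * k * (k + 2))) ∧
    (∀ (Ω : ℕ → Type*) [∀ n, MeasurableSpace (Ω n)] (P : ∀ n, Measure (Ω n))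
      [∀ n, IsProbabilityMeasure (P n)] (W x : ∀ n, ℝ≥0 → Ω n → (Fin n → Fin k) → ℝ),
      (∀ n, 1 ≤ n → IsNoisyConsensus (sierpinskiGraph n k) (P n) (W n) (x n)) →
        Asymptotics.IsEquivalent atTop
          (fun n => firstOrderCoherence (P n) (x n))
          (fun n => ((k : ℝ) ^ 3 + k - 2) / (4 * k * (k + 1) * (k + 2)) *
            (Fintype.card (Fin n → Fin k) : ℝ) ^
              (Real.log ((k : ℝ) + 2) / Real.log (k : ℝ) - 1))) := by
  refine ⟨fun n _ Ω _ P _ W x h => firstOrderCoherence_sierpinskiGraph (by omega) h,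
    fun Ω _ P _ W x h => ?_⟩
  refine (isEquivalent_coherence_formula hk).congr_left ?_
  filter_upwards [eventually_ge_atTop 1] with n hn
  exact (firstOrderCoherence_sierpinskiGraph (by omega) (h n hn)).2.2.symm
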